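/- Fix a set $Var$ of variables with at least two elements and a relational vocabulary (a set of predicate symbols with arities); $X,Y$ range over finite subsets of $Var$. The language $\mathsf{LUD}$ is given by $$\varphi ::= P\vec x \mid \neg\varphi \mid \varphi\wedge\varphi \mid D_X\varphi \mid D_XY \mid K_X\varphi \mid K_XY \mid U(X;Y),$$ and $\mathsf{LUD}^+$ is obtained from it by adding atoms $U_XY$. A metric dependence model consists of metric spaces $(\mathbb D_x,d_x)$ for $x\in Var$, an interpretation $I$ of each $n$-ary predicate symbol as an $n$-ary relation on $\bigcup_x\mathbb D_x$, a set $S$ of states, and surjections $\mathbf x:S\to\mathbb D_x$. Write $\mathbf X(s)=(\mathbf x(s))_{x\in X}$ and $\mathbb D_X=\mathbf X(S)\subseteq\prod_{x\in X}\mathbb D_x$, with the subspace topology of the product topology, metrized by the supremum metric. Let $d_X^S(s,t)=\sup_{x\in X}d_x(\mathbf x(s),\mathbf x(t))$ (with $\sup\emptyset=0$), and let the $X$-topology on $S$ be the weak topology induced by $\mathbf X$. Satisfaction at a state $s$ is defined as follows, with the usual Boolean clauses. - $s\models Px_1\dots x_n$ iff $(\mathbf x_1(s),\dots,\mathbf x_n(s))\in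 I(P)$. - $s\models D_X\varphi$ iff $w\models\varphi$ for all $w\in S$ with $\mathbf X(w)=\mathbf X(s)$. - $s\models D_XY$ iff $\mathbf Y(w)=\mathbf Y(s)$ for all $w\in S$ with $\mathbf X(w)=\mathbf X(s)$. - $s\models K_X\varphi$ iff $s$ lies in the interior of $\{w:w\models\varphi\}$ in the $X$-topology. - $s\models K_XY$ iff there are an $X$-open $O\ni s$ and a continuous $F:\mathbf X(O)\to\mathbb D_Y$ with $F\circ\mathbf X=\mathbf Y$ on $O$. - $s\models U(X;Y)$ iff $\forall\varepsilon>0\,\exists\delta>0\,\forall t,w\in S\,(d^S_X(t,w)<\delta\Rightarrow d^S_Y(t,w)<\varepsilon)$. - $s\models U_XY$ iff there is $\delta_0>0$ such that for all $\varepsilon>0$ there is $\delta>0$ such that all $t,w\in S$ with $d^S_X(s,t)<\delta_0$, $d^S_X(s,w)<\delta_0$ and $d^S_X(t,w)<\delta$ satisfy $d^S_Y(t,w)<\varepsilon$. **Proposition.** Local uniform dependence $U_XY$ is not expressible in $\mathsf{LUD}$: for all finite $X,Y\subseteq Var$ with $X\neq\emptyset$ and $Y\not\subseteq X$, there is no formula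 $\varphi$ of $\mathsf{LUD}$ such that $s\models\varphi\iff s\models U_XY$ holds in every metric dependence model at every state $s$. Hence $\mathsf{LUD}^+$ is strictly more expressive than $\mathsf{LUD}$ on metric dependence models: every formula of $\mathsf{LUD}$ is equivalent to a formula of $\mathsf{LUD}^+$, but some formula of $\mathsf{LUD}^+$ is not equivalent to any formula of $\mathsf{LUD}$ (equivalence meaning satisfaction at the same states of all metric dependence models). -/

import Mathlib

universe uVar uPred uVal uS

/-- A metric dependence model over a set `Var` of variables and a relational vocabulary `Pred`
with arity map `ar`: for each variable `x` a metric space `D x` (a set of values inside `Val`; the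
sets `D x` may overlap), an interpretation of each predicate symbol as a relation of the right arity
on the union of the `D x`, a set `S` of abstract states, and for each variable `x` a surjective map
`val x : S → D x`. -/
structure MetricDependenceModel (Var : Type uVar) (Pred : Type uPred) (ar : Pred → ℕ) where
  Val : Type uVal
  D : Var → Set Val
  metric : ∀ x, MetricSpace (D x)
  interp : (P : Pred) → Set (Fin (ar P) → (⋃ x, D x : Set Val))
  S : Type uS
  val : (x : Var) → S → D x
  val_surjective : ∀ x, Function.Surjective (val x)

attribute [instance] MetricDependenceModel.metric

namespace MetricDependenceModel

variable {Var : Type uVar} {Pred : Type uPred} {ar : Pred → ℕ}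

/-- The value tuple `X(s) = (x(s))_{x ∈ X}` of a finite set of variables, in `∏_{x ∈ X} D x`.
Mathlib's metric on this finite product is the Chebyshev (supremum) metric (identically `0` for
`X = ∅`), and its topology is the product topology. -/
def tuple (M : MetricDependenceModel.{uVar, uPred, uVal, uS} Var Pred ar) (X : Finset Var)
    (s : M.S) : (x : X) → M.D x.1 :=
  fun x => M.val x.1 s

/-- The range `D_X = {X(s) : s ∈ S}` of the joint variable `X`, a subspace of the product. -/
def jointRange (M : MetricDependenceModel.{uVar, uPred, uVal, uS} Var Pred ar) (X : Finset Var) :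
    Set ((x : X) → M.D x.1) :=
  Set.range (M.tuple X)

/-- The joint empirical variable `X : S → D_X`. -/
def joint (M : MetricDependenceModel.{uVar, uPred, uVal, uS} Var Pred ar) (X : Finset Var)
    (s : M.S) : M.jointRange X :=
  ⟨M.tuple X s, s, rfl⟩

/-- The `X`-topology on states: the weak topology induced by the joint variable `X`. -/
@[reducible] def stateTopology (M : MetricDependenceModel.{uVar, uPred, uVal, uS} Var Pred ar)
    (X : Finset Var) : TopologicalSpace M.S :=
  TopologicalSpace.induced (M.joint X) inferInstance

/-- The pseudo-distance `d_X^S(s, t) = d_X(X(s), X(t))` on states. -/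
noncomputable def stateDist (M : MetricDependenceModel.{uVar, uPred, uVal, uS} Var Pred ar)
    (X : Finset Var) (s t : M.S) : ℝ :=
  dist (M.joint X s) (M.joint X t)

/-- Truth of the atom `P x₁ … xₙ` at `s`. -/
def HoldsPred (M : MetricDependenceModel.{uVar, uPred, uVal, uS} Var Pred ar) (P : Pred)
    (xs : Fin (ar P) → Var) (s : M.S) : Prop :=
  (fun i => ⟨(M.val (xs i) s : M.Val),
    Set.mem_iUnion.2 ⟨xs i, (M.val (xs i) s).2⟩⟩) ∈ M.interp P

/-- Exact dependence `D_X Y` at `s`. -/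
def ExactDep (M : MetricDependenceModel.{uVar, uPred, uVal, uS} Var Pred ar) (X Y : Finset Var)
    (s : M.S) : Prop :=
  ∀ w : M.S, M.joint X s = M.joint X w → M.joint Y s = M.joint Y w

/-- Epistemic (locally continuous) dependence `K_X Y` at `s`: on some open `X`-neighbourhood `O`
of `s`, `Y` is a continuous function of `X`. -/
def EpistemicDep (M : MetricDependenceModel.{uVar, uPred, uVal, uS} Var Pred ar)
    (X Y : Finset Var) (s : M.S) : Prop :=
  ∃ O : Set M.S, @IsOpen M.S (M.stateTopology X) O ∧ s ∈ O ∧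
    ∃ F : (M.joint X '' O : Set (M.jointRange X)) → M.jointRange Y, Continuous F ∧
      ∀ t (ht : t ∈ O), F ⟨M.joint X t, Set.mem_image_of_mem _ ht⟩ = M.joint Y t

/-- Global uniform dependence `U(X;Y)`. -/
def UniformDep (M : MetricDependenceModel.{uVar, uPred, uVal, uS} Var Pred ar)
    (X Y : Finset Var) : Prop :=
  ∀ ε : ℝ, 0 < ε → ∃ δ : ℝ, 0 < δ ∧ ∀ s t : M.S,
    M.stateDist X s t < δ → M.stateDist Y s t < ε

/-- Local uniform dependence `U_X Y` at `s`. -/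
def LocalUniformDep (M : MetricDependenceModel.{uVar, uPred, uVal, uS} Var Pred ar)
    (X Y : Finset Var) (s : M.S) : Prop :=
  ∃ δ₀ : ℝ, 0 < δ₀ ∧ ∀ ε : ℝ, 0 < ε → ∃ δ : ℝ, 0 < δ ∧ ∀ t w : M.S,
    M.stateDist X s t < δ₀ → M.stateDist X s w < δ₀ →
      M.stateDist X t w < δ → M.stateDist Y t w < ε

end MetricDependenceModel

/-- Formulas of LUD: `P x₁ … xₙ`, `¬φ`, `φ ∧ ψ`, `D_X φ`, `D_X Y`, `K_X φ`, `K_X Y`, `U(X;Y)`. -/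
inductive LUD (Var : Type uVar) (Pred : Type uPred) (ar : Pred → ℕ) : Type (max uVar uPred) where
  | pred (P : Pred) (xs : Fin (ar P) → Var)
  | neg (φ : LUD Var Pred ar)
  | and (φ ψ : LUD Var Pred ar)
  | exactMod (X : Finset Var) (φ : LUD Var Pred ar)
  | exactDep (X Y : Finset Var)
  | knowMod (X : Finset Var) (φ : LUD Var Pred ar)
  | knowDep (X Y : Finset Var)
  | unifDep (X Y : Finset Var)

/-- Formulas of LUD⁺: those of LUD together with local uniform dependence atoms `U_X Y`. -/
inductive LUDPlus (Var : Type uVar) (Pred : Type uPred) (ar : Pred → ℕ) :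
    Type (max uVar uPred) where
  | pred (P : Pred) (xs : Fin (ar P) → Var)
  | neg (φ : LUDPlus Var Pred ar)
  | and (φ ψ : LUDPlus Var Pred ar)
  | exactMod (X : Finset Var) (φ : LUDPlus Var Pred ar)
  | exactDep (X Y : Finset Var)
  | knowMod (X : Finset Var) (φ : LUDPlus Var Pred ar)
  | knowDep (X Y : Finset Var)
  | unifDep (X Y : Finset Var)
  | localUnifDep (X Y : Finset Var)

/-- Satisfaction `M, s ⊨ φ` for LUD. -/
def LUD.Sat {Var : Type uVar} {Pred : Type uPred} {ar : Pred → ℕ}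
    (M : MetricDependenceModel.{uVar, uPred, uVal, uS} Var Pred ar) :
    LUD Var Pred ar → M.S → Prop
  | .pred P xs, s => M.HoldsPred P xs s
  | .neg φ, s => ¬ LUD.Sat M φ s
  | .and φ ψ, s => LUD.Sat M φ s ∧ LUD.Sat M ψ s
  | .exactMod X φ, s => ∀ w : M.S, M.joint X s = M.joint X w → LUD.Sat M φ w
  | .exactDep X Y, s => M.ExactDep X Y s
  | .knowMod X φ, s => s ∈ @interior M.S (M.stateTopology X) {w | LUD.Sat M φ w}
  | .knowDep X Y, s => M.EpistemicDep X Y s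
  | .unifDep X Y, _ => M.UniformDep X Y

/-- Satisfaction `M, s ⊨ φ` for LUD⁺. -/
def LUDPlus.Sat {Var : Type uVar} {Pred : Type uPred} {ar : Pred → ℕ}
    (M : MetricDependenceModel.{uVar, uPred, uVal, uS} Var Pred ar) :
    LUDPlus Var Pred ar → M.S → Prop
  | .pred P xs, s => M.HoldsPred P xs s
  | .neg φ, s => ¬ LUDPlus.Sat M φ s
  | .and φ ψ, s => LUDPlus.Sat M φ s ∧ LUDPlus.Sat M ψ s
  | .exactMod X φ, s => ∀ w : M.S, M.joint X s = M.joint X w → LUDPlus.Sat M φ w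
  | .exactDep X Y, s => M.ExactDep X Y s
  | .knowMod X φ, s => s ∈ @interior M.S (M.stateTopology X) {w | LUDPlus.Sat M φ w}
  | .knowDep X Y, s => M.EpistemicDep X Y s
  | .unifDep X Y, _ => M.UniformDep X Y
  | .localUnifDep X Y, s => M.LocalUniformDep X Y s

/-!
A formula of LUD sees only the topology of a model and its global uniform structure. If every
nonempty set of variables induces the same topology on the states and no predicate separates states,
then `D_X Y` and `K_X Y` hold everywhere for `X ≠ ∅`, and by induction every formula has the same
truth value at all states. Now let `f` be a continuous function on a metric space `E`, let the
variables in `X` measure the metric of `E`, and let all other variables measure the metric of the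
graph of `f`. These metrics are topologically equivalent, but for `Y ⊄ X` the atom `U_X Y` holds
exactly at the points near which `f` is uniformly continuous. It remains to pick `f` that is
uniformly continuous near one point but not near another: on the plane without the nonzero points of
its horizontal axis take `f (a, b) = a * sign b`, which is uniformly continuous near `(0, 1)` but
jumps by `2 * |a|` across the missing points `(a, 0)`, which accumulate at the origin.
-/

universe w

namespace MetricDependenceModel

section DependenceAtoms

variable {Var : Type uVar} {Pred : Type uPred} {ar : Pred → ℕ}
  (M : MetricDependenceModel.{uVar, uPred, uVal, uS} Var Pred ar) {X Y : Finset Var}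

theorem joint_empty (s t : M.S) : M.joint ∅ s = M.joint ∅ t :=
  Subtype.ext (Subsingleton.elim _ _)

theorem stateDist_le_iff {s t : M.S} {r : ℝ} (hr : 0 ≤ r) :
    M.stateDist X s t ≤ r ↔ ∀ x ∈ X, dist (M.val x s) (M.val x t) ≤ r :=
  (dist_pi_le_iff hr).trans Subtype.forall

theorem dist_val_le_stateDist {x : Var} (hx : x ∈ X) (s t : M.S) :
    dist (M.val x s) (M.val x t) ≤ M.stateDist X s t :=
  dist_le_pi_dist (M.tuple X s) (M.tuple X t) ⟨x, hx⟩

theorem stateTopology_eq_iInf (X : Finset Var) :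
    M.stateTopology X = ⨅ x ∈ X, TopologicalSpace.induced (M.val x) inferInstance := by
  simp only [stateTopology, instTopologicalSpaceSubtype, induced_compose, Pi.topologicalSpace,
    induced_iInf, iInf_subtype]
  rfl

theorem isInducing_joint (X : Finset Var) :
    @Topology.IsInducing _ _ (M.stateTopology X) _ (M.joint X) :=
  @Topology.IsInducing.mk _ _ (M.stateTopology X) _ _ rfl

theorem joint_surjective (X : Finset Var) : Function.Surjective (M.joint X) := by
  rintro ⟨_, s, rfl⟩
  exact ⟨s, rfl⟩

theorem isQuotientMap_joint (X : Finset Var) :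
    @Topology.IsQuotientMap _ _ (M.stateTopology X) _ (M.joint X) := by
  let := M.stateTopology X
  have hX := M.isInducing_joint X
  have hsurj := M.joint_surjective X
  exact (hX.isOpenMap (hsurj.range_eq ▸ isOpen_univ)).isQuotientMap hX.continuous hsurj

theorem exactDep_congr {s t : M.S} (h : M.joint X s = M.joint X t) :
    M.ExactDep X Y s ↔ M.ExactDep X Y t := by
  have transfer : ∀ {s t : M.S}, M.joint X s = M.joint X t → M.ExactDep X Y s → M.ExactDep X Y t :=
    fun hst hs w hw => (hs _ hst).symm.trans (hs w (hst.trans hw))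
  exact ⟨transfer h, transfer h.symm⟩

theorem epistemicDep_congr {s t : M.S} (h : M.joint X s = M.joint X t) :
    M.EpistemicDep X Y s ↔ M.EpistemicDep X Y t := by
  refine exists_congr fun O => and_congr_right fun hO => and_congr_left fun _ => ?_
  obtain ⟨T, -, rfl⟩ := isOpen_induced_iff.1 hO
  rw [Set.mem_preimage, Set.mem_preimage, h]

theorem exactDep_of_stateTopology_le (h : M.stateTopology X ≤ M.stateTopology Y) (s : M.S) :
    M.ExactDep X Y s := by
  intro w hw
  let := M.stateTopology X
  have hY : Continuous (M.joint Y) := continuous_iff_le_induced.2 h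
  exact (((M.isInducing_joint X).inseparable_iff.1 (.of_eq hw)).map hY).eq

theorem epistemicDep_of_stateTopology_le (h : M.stateTopology X ≤ M.stateTopology Y) (s : M.S) :
    M.EpistemicDep X Y s := by
  let := M.stateTopology X
  have hX : Topology.IsQuotientMap (M.joint X) := M.isQuotientMap_joint X
  have hY : Continuous (M.joint Y) := continuous_iff_le_induced.2 h
  let F : M.jointRange X → M.jointRange Y := fun v => M.joint Y (Function.surjInv hX.surjective v)
  have hFX : F ∘ M.joint X = M.joint Y := funext fun t =>
    M.exactDep_of_stateTopology_le h _ t (Function.surjInv_eq hX.surjective _)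
  have hF : Continuous F := hX.continuous_iff.2 (hFX ▸ hY)
  exact ⟨Set.univ, isOpen_univ, Set.mem_univ s, fun v => F v, hF.comp continuous_subtype_val,
    fun t _ => congrFun hFX t⟩

end DependenceAtoms

end MetricDependenceModel

namespace LUD

section Homogeneity

variable {Var : Type uVar} {Pred : Type uPred} {ar : Pred → ℕ}
  (M : MetricDependenceModel.{uVar, uPred, uVal, uS} Var Pred ar)

theorem sat_iff_sat_of_atoms
    (hP : ∀ P xs s t, M.HoldsPred P xs s ↔ M.HoldsPred P xs t)
    (hD : ∀ X Y s t, M.ExactDep X Y s ↔ M.ExactDep X Y t)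
    (hK : ∀ X Y s t, M.EpistemicDep X Y s ↔ M.EpistemicDep X Y t)
    (φ : LUD Var Pred ar) (s t : M.S) : φ.Sat M s ↔ φ.Sat M t := by
  induction φ generalizing s t with
  | pred P xs => exact hP P xs s t
  | neg φ ih => exact not_congr (ih s t)
  | and φ ψ ihφ ihψ => exact and_congr (ihφ s t) (ihψ s t)
  | exactMod X φ ih =>
    exact ⟨fun h w _ => (ih s w).1 (h s rfl), fun h w _ => (ih t w).1 (h t rfl)⟩
  | exactDep X Y => exact hD X Y s t
  | knowMod X φ ih =>
    rcases Set.eq_empty_or_nonempty {w | φ.Sat M w} with hφ | ⟨w₀, hw₀⟩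
    · simp only [Sat, hφ, interior_empty, Set.mem_empty_iff_false]
    · have hφ : {w | φ.Sat M w} = Set.univ := Set.eq_univ_of_forall fun w => (ih w₀ w).1 hw₀
      simp only [Sat, hφ, interior_univ, Set.mem_univ]
  | knowDep X Y => exact hK X Y s t
  | unifDep X Y => exact Iff.rfl

theorem sat_iff_sat_of_stateTopology_le
    (hP : ∀ P xs s t, M.HoldsPred P xs s ↔ M.HoldsPred P xs t)
    (hM : ∀ X Y : Finset Var, X.Nonempty → M.stateTopology X ≤ M.stateTopology Y)
    (φ : LUD Var Pred ar) (s t : M.S) : φ.Sat M s ↔ φ.Sat M t := by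
  refine sat_iff_sat_of_atoms M hP (fun X Y s t => ?_) (fun X Y s t => ?_) φ s t <;>
    rcases X.eq_empty_or_nonempty with rfl | hX
  · exact M.exactDep_congr (M.joint_empty s t)
  · exact iff_of_true (M.exactDep_of_stateTopology_le (hM X Y hX) s)
      (M.exactDep_of_stateTopology_le (hM X Y hX) t)
  · exact M.epistemicDep_congr (M.joint_empty s t)
  · exact iff_of_true (M.epistemicDep_of_stateTopology_le (hM X Y hX) s)
      (M.epistemicDep_of_stateTopology_le (hM X Y hX) t)

end Homogeneity

end LUD

namespace MetricDependenceModel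

section OfMetrics

variable {Var : Type uVar} {Pred : Type uPred} (ar : Pred → ℕ) {E : Type w}

/-- The dependence model in which no predicate holds, every variable takes the state, a point of
`E`, as its value, and the variable `x` measures distances by the metric `m x`. The lifts allow any
universes for states and values. -/
def ofMetrics (m : Var → MetricSpace E) :
    MetricDependenceModel.{uVar, uPred, max w uVal, max w uS} Var Pred ar where
  Val := ULift.{uVal} E
  D _ := Set.univ
  metric x := (m x).induced (fun v => v.1.down)
    (ULift.down_injective.comp Subtype.val_injective)
  interp _ := ∅
  S := ULift.{uS} E
  val _ s := ⟨ULift.up s.down, Set.mem_univ _⟩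
  val_surjective _ v := ⟨ULift.up v.1.down, rfl⟩

variable {ar} {m : Var → MetricSpace E}

/-- The identification of the states of `ofMetrics ar m` with the points of `E`. -/
def ofMetrics.point : (ofMetrics.{uVar, uPred, uVal, uS, w} ar m).S ≃ E := Equiv.ulift

open ofMetrics (point)

theorem dist_val_ofMetrics (x : Var) (s t : (ofMetrics.{uVar, uPred, uVal, uS, w} ar m).S) :
    dist ((ofMetrics ar m).val x s) ((ofMetrics ar m).val x t) =
      (m x).dist (point s) (point t) :=
  rfl

theorem stateTopology_ofMetrics (X : Finset Var) :
    (ofMetrics.{uVar, uPred, uVal, uS, w} ar m).stateTopology X =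
      ⨅ x ∈ X, TopologicalSpace.induced point (m x).toUniformSpace.toTopologicalSpace := by
  rw [stateTopology_eq_iInf]
  exact iInf_congr fun x => iInf_congr fun _ => induced_compose

theorem sat_ofMetrics_iff_sat {τ : TopologicalSpace E}
    (hm : ∀ x, (m x).toUniformSpace.toTopologicalSpace = τ) (φ : LUD Var Pred ar)
    (s t : (ofMetrics.{uVar, uPred, uVal, uS, w} ar m).S) :
    φ.Sat (ofMetrics ar m) s ↔ φ.Sat (ofMetrics ar m) t := by
  refine LUD.sat_iff_sat_of_stateTopology_le _ (fun _ _ _ _ => Iff.rfl) (fun X Y hX => ?_) φ s t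
  obtain ⟨x, hx⟩ := hX
  simp only [stateTopology_ofMetrics, hm]
  exact (iInf₂_le x hx).trans (le_iInf₂ fun _ _ => le_rfl)

end OfMetrics

section GraphModel

open ofMetrics (point)

variable {E : Type w} [MetricSpace E] {F : Type*} [MetricSpace F]

/-- The metric `max (dist p q) (dist (f p) (f q))` pulled back from the graph of `f`. -/
abbrev graphMetric (f : E → F) : MetricSpace E :=
  MetricSpace.induced (fun p => (p, f p)) (fun _ _ h => congrArg Prod.fst h) inferInstance

theorem topology_graphMetric {f : E → F} (hf : Continuous f) :
    (graphMetric f).toUniformSpace.toTopologicalSpace =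
      ‹MetricSpace E›.toUniformSpace.toTopologicalSpace :=
  (isEmbedding_graph hf).eq_induced.symm

variable {Var : Type uVar} [DecidableEq Var] {Pred : Type uPred} {ar : Pred → ℕ}
  {X Y : Finset Var} {f : E → F}

/-- The model on `E` in which the variables in `X` use the metric of `E` and all others the metric
of the graph of `f`. -/
abbrev graphModel (ar : Pred → ℕ) (X : Finset Var) (f : E → F) :
    MetricDependenceModel.{uVar, uPred, max w uVal, max w uS} Var Pred ar :=
  ofMetrics ar fun x => if x ∈ X then ‹MetricSpace E› else graphMetric f

theorem sat_graphModel_iff_sat (hf : Continuous f) (φ : LUD Var Pred ar)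
    (s t : (graphModel.{uVar, uPred, uVal, uS, w} ar X f).S) :
    φ.Sat (graphModel ar X f) s ↔ φ.Sat (graphModel ar X f) t := by
  refine sat_ofMetrics_iff_sat (τ := inferInstance) (fun x => ?_) φ s t
  by_cases hx : x ∈ X
  · rw [if_pos hx]
  · rw [if_neg hx, topology_graphMetric hf]

theorem dist_val_graphModel_of_mem {x : Var} (hx : x ∈ X)
    (s t : (graphModel.{uVar, uPred, uVal, uS, w} ar X f).S) :
    dist ((graphModel ar X f).val x s) ((graphModel ar X f).val x t) =
      dist (point s) (point t) := by
  rw [dist_val_ofMetrics, if_pos hx]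

theorem dist_val_graphModel_of_notMem {x : Var} (hx : x ∉ X)
    (s t : (graphModel.{uVar, uPred, uVal, uS, w} ar X f).S) :
    dist ((graphModel ar X f).val x s) ((graphModel ar X f).val x t) =
      max (dist (point s) (point t)) (dist (f (point s)) (f (point t))) := by
  rw [dist_val_ofMetrics, if_neg hx]
  rfl

theorem stateDist_graphModel_self (hX : X.Nonempty)
    (s t : (graphModel.{uVar, uPred, uVal, uS, w} ar X f).S) :
    (graphModel ar X f).stateDist X s t = dist (point s) (point t) := by
  obtain ⟨x, hx⟩ := hX
  refine le_antisymm ((stateDist_le_iff _ dist_nonneg).2 fun y hy => ?_) ?_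
  · exact (dist_val_graphModel_of_mem hy s t).le
  · exact (dist_val_graphModel_of_mem hx s t).ge.trans (dist_val_le_stateDist _ hx s t)

theorem stateDist_graphModel_of_not_subset (hY : ¬ Y ⊆ X)
    (s t : (graphModel.{uVar, uPred, uVal, uS, w} ar X f).S) :
    (graphModel ar X f).stateDist Y s t =
      max (dist (point s) (point t)) (dist (f (point s)) (f (point t))) := by
  obtain ⟨y, hyY, hyX⟩ := Finset.not_subset.1 hY
  refine le_antisymm ((stateDist_le_iff _ (le_max_of_le_left dist_nonneg)).2 fun z _ => ?_) ?_
  · by_cases hz : z ∈ X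
    · exact (dist_val_graphModel_of_mem hz s t).trans_le (le_max_left _ _)
    · exact (dist_val_graphModel_of_notMem hz s t).le
  · exact (dist_val_graphModel_of_notMem hyX s t).ge.trans (dist_val_le_stateDist _ hyY s t)

theorem localUniformDep_graphModel_iff (hX : X.Nonempty) (hY : ¬ Y ⊆ X)
    (s : (graphModel.{uVar, uPred, uVal, uS, w} ar X f).S) :
    (graphModel ar X f).LocalUniformDep X Y s ↔
      ∃ U ∈ nhds (point s), UniformContinuousOn f U := by
  rw [Metric.nhds_basis_ball.exists_iff fun _ _ hUV hV => hV.mono hUV]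
  simp only [LocalUniformDep, stateDist_graphModel_self hX, stateDist_graphModel_of_not_subset hY,
    Metric.uniformContinuousOn_iff, Metric.mem_ball', max_lt_iff]
  refine exists_congr fun r => and_congr_right fun _ => ⟨fun h ε hε => ?_, fun h ε hε => ?_⟩
  · obtain ⟨δ, hδ, hclose⟩ := h ε hε
    refine ⟨δ, hδ, fun p hp q hq hpq => ?_⟩
    simpa using (hclose (point.symm p) (point.symm q) (by simpa) (by simpa) (by simpa)).2
  · obtain ⟨δ, hδ, hclose⟩ := h ε hε
    exact ⟨min δ ε, lt_min hδ hε, fun t w ht hw htw =>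
      ⟨htw.trans_le (min_le_right _ _), hclose _ ht _ hw (htw.trans_le (min_le_left _ _))⟩⟩

end GraphModel

end MetricDependenceModel

/-- The plane without the nonzero points of its horizontal axis; at the origin its upper and lower
halves are joined. -/
def pinchedPlane : Set (ℝ × ℝ) := {p | p.2 = 0 → p.1 = 0}

/-- The function equal to the first coordinate on the upper half plane and to its negative on the
lower one, a separating example for local uniform continuity on `pinchedPlane`. -/
noncomputable def signedAbscissa (p : ℝ × ℝ) : ℝ := p.1 * SignType.sign p.2

theorem norm_signedAbscissa_le (p : ℝ × ℝ) : ‖signedAbscissa p‖ ≤ ‖p.1‖ := by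
  rcases lt_trichotomy p.2 0 with h | h | h <;> simp [signedAbscissa, h]

theorem continuousOn_signedAbscissa : ContinuousOn signedAbscissa pinchedPlane := by
  intro p hp
  refine ContinuousAt.continuousWithinAt ?_
  by_cases hp₂ : p.2 = 0
  · have hp₁ : p.1 = 0 := hp hp₂
    have hvalue : signedAbscissa p = 0 := by simp [signedAbscissa, hp₁]
    rw [ContinuousAt, hvalue]
    exact squeeze_zero_norm norm_signedAbscissa_le
      (continuous_fst.norm.tendsto' p 0 (by simp [hp₁]))
  · have hcast : Continuous ((↑) : SignType → ℝ) := continuous_of_discreteTopology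
    have hsign : ContinuousAt (fun q : ℝ × ℝ => SignType.sign q.2) p :=
      (continuousAt_sign_of_ne_zero hp₂).comp continuousAt_snd
    exact continuousAt_fst.mul (hcast.continuousAt.comp hsign)

theorem uniformContinuousOn_signedAbscissa_upperHalfPlane :
    UniformContinuousOn signedAbscissa {p | 0 < p.2} :=
  uniformContinuous_fst.uniformContinuousOn.congr fun p (hp : 0 < p.2) => by
    simp [signedAbscissa, hp]

theorem exists_dist_lt_and_dist_signedAbscissa_eq {r δ : ℝ} (hr : 0 < r) (hδ : 0 < δ) :
    ∃ p ∈ Metric.ball 0 r ∩ pinchedPlane, ∃ q ∈ Metric.ball 0 r ∩ pinchedPlane,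
      dist p q < δ ∧ dist (signedAbscissa p) (signedAbscissa q) = r := by
  obtain ⟨η, hη, hη_lt⟩ := exists_between (lt_min (half_pos hδ) hr)
  obtain ⟨hηδ, hηr⟩ := lt_min_iff.1 hη_lt
  have hmem : ∀ b : ℝ, b ≠ 0 → |b| < r → (r / 2, b) ∈ Metric.ball 0 r ∩ pinchedPlane := by
    intro b hb hbr
    refine ⟨?_, fun h => absurd h hb⟩
    rw [mem_ball_zero_iff, Prod.norm_mk, Real.norm_of_nonneg (half_pos hr).le]
    exact max_lt (half_lt_self hr) hbr
  refine ⟨(r / 2, η), hmem η hη.ne' (by rwa [abs_of_pos hη]),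
    (r / 2, -η), hmem (-η) (neg_ne_zero.2 hη.ne') (by rwa [abs_neg, abs_of_pos hη]), ?_, ?_⟩
  · rw [Prod.dist_eq, dist_self, max_eq_right dist_nonneg, Real.dist_eq, abs_lt]
    constructor <;> linarith
  · simp [signedAbscissa, hη, Real.dist_eq, abs_of_pos hr]

theorem not_uniformContinuousOn_signedAbscissa_nhds_zero {U : Set pinchedPlane}
    (hU : U ∈ nhds ⟨0, fun _ => rfl⟩) :
    ¬ UniformContinuousOn (pinchedPlane.domRestrict signedAbscissa) U := by
  intro hunif
  obtain ⟨r, hr, hball⟩ := Metric.mem_nhds_iff.1 hU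
  obtain ⟨δ, hδ, hclose⟩ := Metric.uniformContinuousOn_iff.1 hunif r hr
  obtain ⟨p, ⟨hpr, hp⟩, q, ⟨hqr, hq⟩, hpq, hjump⟩ :=
    exists_dist_lt_and_dist_signedAbscissa_eq hr hδ
  exact (hclose ⟨p, hp⟩ (hball hpr) ⟨q, hq⟩ (hball hqr) hpq).ne hjump

theorem exists_continuous_uniformContinuousOn_nhds_and_not :
    ∃ f : pinchedPlane → ℝ, Continuous f ∧
      (∃ p, ∃ U ∈ nhds p, UniformContinuousOn f U) ∧
      ∃ q, ¬ ∃ U ∈ nhds q, UniformContinuousOn f U := by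
  refine ⟨pinchedPlane.domRestrict signedAbscissa, continuousOn_signedAbscissa.domRestrict,
    ⟨⟨(0, 1), fun _ => rfl⟩, Subtype.val ⁻¹' {p | 0 < p.2}, ?_, ?_⟩,
    ⟨0, fun _ => rfl⟩, fun ⟨U, hU, hunif⟩ =>
      not_uniformContinuousOn_signedAbscissa_nhds_zero hU hunif⟩
  · have hopen : IsOpen {p : ℝ × ℝ | 0 < p.2} := isOpen_lt continuous_const continuous_snd
    exact (hopen.preimage continuous_subtype_val).mem_nhds (zero_lt_one (α := ℝ))
  · exact uniformContinuousOn_signedAbscissa_upperHalfPlane.comp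
      uniformContinuous_subtype_val.uniformContinuousOn (Set.mapsTo_preimage _ _)

namespace LUD

variable {Var : Type uVar} {Pred : Type uPred}

/-- The inclusion of LUD in LUD⁺. -/
def toPlus {ar : Pred → ℕ} : LUD Var Pred ar → LUDPlus Var Pred ar
  | .pred P xs => .pred P xs
  | .neg φ => .neg φ.toPlus
  | .and φ ψ => .and φ.toPlus ψ.toPlus
  | .exactMod X φ => .exactMod X φ.toPlus
  | .exactDep X Y => .exactDep X Y
  | .knowMod X φ => .knowMod X φ.toPlus
  | .knowDep X Y => .knowDep X Y
  | .unifDep X Y => .unifDep X Y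

theorem sat_toPlus {ar : Pred → ℕ}
    (M : MetricDependenceModel.{uVar, uPred, uVal, uS} Var Pred ar) (φ : LUD Var Pred ar)
    (s : M.S) : φ.toPlus.Sat M s ↔ φ.Sat M s := by
  induction φ generalizing s with
  | pred | exactDep | knowDep | unifDep => rfl
  | neg φ ih => simp only [toPlus, LUDPlus.Sat, Sat, ih]
  | and φ ψ ihφ ihψ => simp only [toPlus, LUDPlus.Sat, Sat, ihφ, ihψ]
  | exactMod X φ ih => simp only [toPlus, LUDPlus.Sat, Sat, ih]
  | knowMod X φ ih => simp only [toPlus, LUDPlus.Sat, Sat, ih]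

theorem not_exists_sat_iff_localUniformDep (ar : Pred → ℕ) {X Y : Finset Var} (hX : X.Nonempty)
    (hY : ¬ Y ⊆ X) :
    ¬ ∃ φ : LUD Var Pred ar,
      ∀ (M : MetricDependenceModel.{uVar, uPred, uVal, uS} Var Pred ar) (s : M.S),
        φ.Sat M s ↔ M.LocalUniformDep X Y s := by
  classical
  rintro ⟨φ, hφ⟩
  obtain ⟨f, hf, ⟨p, hp⟩, q, hq⟩ := exists_continuous_uniformContinuousOn_nhds_and_not
  let M := MetricDependenceModel.graphModel.{uVar, uPred, uVal, uS} ar X f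
  let state : pinchedPlane → M.S := MetricDependenceModel.ofMetrics.point.symm
  have hdep : ∀ r, φ.Sat M (state r) ↔ ∃ U ∈ nhds r, UniformContinuousOn f U := fun r =>
    (hφ M (state r)).trans (MetricDependenceModel.localUniformDep_graphModel_iff hX hY _)
  exact hq ((hdep q).1 ((MetricDependenceModel.sat_graphModel_iff_sat hf φ _ _).1 ((hdep p).2 hp)))

end LUD

theorem mainTheorem4 {Var : Type uVar} [Nontrivial Var] {Pred : Type uPred} (ar : Pred → ℕ) :
    (∀ X Y : Finset Var, X.Nonempty → ¬ Y ⊆ X →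
      ¬ ∃ φ : LUD Var Pred ar,
        ∀ (M : MetricDependenceModel.{uVar, uPred, uVal, uS} Var Pred ar) (s : M.S),
          LUD.Sat M φ s ↔ M.LocalUniformDep X Y s) ∧
    ((∀ φ : LUD Var Pred ar, ∃ ψ : LUDPlus Var Pred ar,
        ∀ (M : MetricDependenceModel.{uVar, uPred, uVal, uS} Var Pred ar) (s : M.S),
          LUDPlus.Sat M ψ s ↔ LUD.Sat M φ s) ∧
     (∃ ψ : LUDPlus Var Pred ar, ¬ ∃ φ : LUD Var Pred ar,
        ∀ (M : MetricDependenceModel.{uVar, uPred, uVal, uS} Var Pred ar) (s : M.S),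
          LUD.Sat M φ s ↔ LUDPlus.Sat M ψ s)) := by
  obtain ⟨x, y, hxy⟩ := exists_pair_ne Var
  have hyx : ¬ ({y} : Finset Var) ⊆ {x} := by simpa using hxy.symm
  exact ⟨fun X Y hX hY => LUD.not_exists_sat_iff_localUniformDep ar hX hY,
    fun φ => ⟨φ.toPlus, fun M s => LUD.sat_toPlus M φ s⟩,
    .localUnifDep {x} {y},
    LUD.not_exists_sat_iff_localUniformDep ar (Finset.singleton_nonempty x) hyx⟩
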